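/- **Setting.** An alternating transition system is $T=(Q,A,B,\to,O,H)$ with $\to\,\subseteq Q\times A\times B\times Q$ and $H:Q\to O$; it is finite if $Q,A,B$ are finite, and non-blocking if for all $q\in Q$, $a\in A$, $b\in B$ there is $q'$ with $q\xrightarrow{a,b}q'$. A control strategy is a function $f:Q^+\to A$, and $Out(q,f)$ is the set of all $\sigma\in Q^\omega$ such that $\sigma[1]=q$ and for every $i\ge 1$ there is $b\in B$ with $\sigma[i]\xrightarrow{f(\sigma[1,i]),\,b}\sigma[i+1]$. LTL$_{-X}$ formulas over a finite set $\mathbb P$ are built from $p\in\mathbb P$ by $\neg,\wedge,\mathbf U$ with the usual semantics over words in $(2^{\mathbb P})^\omega$; for $\Pi:Q\to 2^{\mathbb P}$, $\sigma\models\phi$ means that $\Pi(\sigma[1])\Pi(\sigma[2])\cdots$ satisfies $\phi$ at its first position. A reactive plan of $T$ with initial state $q_0$ is a finite set of rules $\{(i,q_i,a_i,N_i):1\le i\le k\}$, $k\ge1$, with $q_1=q_0$, $a_i\in A$, $N_i\subseteq\{1,\dots,k\}$, such that for every $i$ the set $\{q_j:j\in N_i\}$ equals $\{q':\exists b\in B,\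 q_i\xrightarrow{a_i,b}q'\}$. It generates $\sigma\in Q^\omega$ if there are $i_1=1,i_2,i_3,\dots$ with $i_{t+1}\in N_{i_t}$ and $\sigma[t]=q_{i_t}$ for all $t$. It satisfies $\phi$ if it generates at least one sequence and every sequence it generates satisfies $\phi$. **Algorithm 1 with planning subroutine $K$.** For all $q_0\in Q$ in turn: call $K$ on $(T,q_0,\phi,\Pi)$; if it returns a plan $RP$, simplify it, and return $q_0$ and the strategy $f$ of the simplified plan. If no call returns a plan, return false. *Simplification.* For the first plan state $i$ that lies on a cycle and is reachable from $1$, let $\mathit{prefix}$ be a shortest path (with at least one edge) from $1$ to $i$ and $\mathit{suffix}$ one from $i$ to $i$ (both empty if there is no such $i$). In every $N_i$, for every maximal group $j_1<\dots<j_m$, $m>1$, of elements with the same label $q_j$, keep one and remove the others: one that follows $i$ in $\mathit{prefix}$ if there is one, otherwise one that follows $i$ in $\mathit{suffix}$ if there is one, otherwise $j_1$. *Strategy.* On input $s\in Q^+$: if $s[1]=q_1$ and, starting in plan state $1$ and moving for $t=2,\dots,|s|$ from the current plan state $c$ to a $j\in N_c$ with $q_j=s[t]$, one can read all of $s$, then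 $f(s)$ is the action of the plan state reached; otherwise $f(s)=a_1$. **Statement.** Let $T$ be a finite, non-blocking alternating transition system, $\phi$ an LTL$_{-X}(\mathbb P)$ formula and $\Pi:Q\to2^{\mathbb P}$ a valuation. Suppose that, for some initial state, there is a reactive plan of $T$ satisfying $\phi$. Then: 1. For every planning subroutine $K$ which, for each $q_0\in Q$, returns only reactive plans of $T$ with initial state $q_0$ satisfying $\phi$, and returns one whenever one exists, Algorithm 1 with $K$ returns some $q\in Q$ and $f:Q^+\to A$ such that $\sigma\models\phi$ for all $\sigma\in Out(q,f)$. 2. Such a subroutine is realized by explicit search: let $K_d$ search exhaustively through the candidate plans with at most $d$ rules, in order of size, testing each for being a reactive plan with the required initial state and for satisfying $\phi$ (by tableau model checking). There is $d_0$ such that for all $d\ge d_0$ and all $q_0\in Q$, $K_d$ has the property required in 1. 3. Consequently the algorithm that runs Algorithm 1 with $K_0,K_1,K_2,\dots$ until a run does not return false terminates and returns some $q\in Q$ and $f:Q^+\to A$ such that $\sigma\models\phi$ for all $\sigma\in Out(q,f)$. -/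

import Mathlib

/-! ### Alternating transition systems and control strategies -/

/-- An alternating transition system `(Q, A, B, ⟶, O, H)`. -/
structure ATS (Q A B O : Type*) where
  /-- `Trans q a b q'` is `q --a,b--> q'`. -/
  Trans : Q → A → B → Q → Prop
  /-- The observation function. -/
  obs : Q → O

/-- Non-empty finite strings. -/
abbrev NEString (Q : Type*) := {s : List Q // s ≠ []}

/-- A control strategy is any function `Q⁺ → A`. -/
abbrev Strategy (Q A : Type*) := NEString Q → A

/-- The prefix `σ[1,i+1]`; infinite sequences are indexed from `0`, so it is `σ 0, …, σ i`. -/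
def seqPrefix {Q : Type*} (σ : ℕ → Q) (i : ℕ) : NEString Q :=
  ⟨(List.range (i + 1)).map σ, by simp⟩

namespace ATS

variable {Q A B O : Type*}

/-- Every pair of a control label and a disturbance label has a successor in every state. -/
def NonBlocking (T : ATS Q A B O) : Prop :=
  ∀ q a b, ∃ q', T.Trans q a b q'

/-- The infinite outcomes of the strategy `f` from `q`. -/
def Out (T : ATS Q A B O) (q : Q) (f : Strategy Q A) : Set (ℕ → Q) :=
  {σ | σ 0 = q ∧ ∀ i, ∃ b, T.Trans (σ i) (f (seqPrefix σ i)) b (σ (i + 1))}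

end ATS

/-! ### The logic LTL without next -/

/-- Formulae `p | ¬ φ | φ ∧ ψ | φ U ψ`. -/
inductive LTL (P : Type*) where
  | atom (p : P) : LTL P
  | neg (φ : LTL P) : LTL P
  | conj (φ ψ : LTL P) : LTL P
  | untl (φ ψ : LTL P) : LTL P
deriving DecidableEq

namespace LTL

variable {P : Type*}

/-- Satisfaction at position `i` of an infinite word over `2^P`. -/
def SatAt (w : ℕ → Finset P) : LTL P → ℕ → Prop
  | atom p, i => p ∈ w i
  | neg φ, i => ¬ SatAt w φ i
  | conj φ ψ, i => SatAt w φ i ∧ SatAt w ψ i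
  | untl φ ψ, i => ∃ j, i ≤ j ∧ SatAt w ψ j ∧ ∀ k, i ≤ k → k < j → SatAt w φ k

/-- The sequence of states `σ` satisfies `φ` with respect to the valuation `val`. -/
def Holds {Q : Type*} (val : Q → Finset P) (σ : ℕ → Q) (φ : LTL P) : Prop :=
  SatAt (fun i => val (σ i)) φ 0

/-- The subformulae of a formula (including itself). -/
def subs [DecidableEq P] : LTL P → Finset (LTL P)
  | atom p => {atom p}
  | neg φ => insert (neg φ) φ.subs
  | conj φ ψ => insert (conj φ ψ) (φ.subs ∪ ψ.subs)
  | untl φ ψ => insert (untl φ ψ) (φ.subs ∪ ψ.subs)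

end LTL

/-! ### Reactive agents and reactive plans -/

/-- A reactive agent `(q₀, succ)`: `succ q` lists the triples (action executable in `q`, its
duration, the set of its nondeterministic successors). -/
structure ReactiveAgent (Q A : Type*) where
  init : Q
  succ : Q → List (A × ℝ × Finset Q)
  dur_pos : ∀ q, ∀ e ∈ succ q, 0 < e.2.1

/-- `q'` is a successor of `q` resulting from the execution of `a`. -/
def ReactiveAgent.Step {Q A : Type*} (ag : ReactiveAgent Q A) (q : Q) (a : A) (q' : Q) : Prop :=
  ∃ e ∈ ag.succ q, e.1 = a ∧ q' ∈ e.2.2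

/-- A set of situation control rules `{(i, qᵢ, aᵢ, Nᵢ) : i = 1, …, n + 1}`. Plan state `i`
is represented by `i - 1 : Fin (n + 1)`; in particular the initial plan state `1` is `0`. -/
structure Plan (Q A : Type*) where
  n : ℕ
  label : Fin (n + 1) → Q
  act : Fin (n + 1) → A
  next : Fin (n + 1) → Finset (Fin (n + 1))

namespace Plan

variable {Q A P : Type*}

/-- `R` is a reactive plan of the agent: it starts in the initial world state, each action is
executable where it is prescribed, every successor of the world state of `i` is the label of some
plan state in `Nᵢ`, and `Nᵢ` contains only plan states labelled by such successors. -/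
def IsPlanOf (R : Plan Q A) (ag : ReactiveAgent Q A) : Prop :=
  R.label 0 = ag.init ∧
  (∀ i, ∃ e ∈ ag.succ (R.label i), e.1 = R.act i) ∧
  (∀ i, ∀ q', ag.Step (R.label i) (R.act i) q' → ∃ j ∈ R.next i, R.label j = q') ∧
  (∀ i, ∀ j ∈ R.next i, ag.Step (R.label i) (R.act i) (R.label j))

/-- The infinite sequence of world states `σ` is a trajectory generated by the plan. -/
def Generates (R : Plan Q A) (σ : ℕ → Q) : Prop :=
  ∃ ρ : ℕ → Fin (R.n + 1), ρ 0 = 0 ∧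
    ∀ t, ρ (t + 1) ∈ R.next (ρ t) ∧ R.label (ρ t) = σ t

/-- All generated trajectories satisfy `φ`, and there is at least one. -/
def Satisfies (R : Plan Q A) (val : Q → Finset P) (φ : LTL P) : Prop :=
  (∀ σ, R.Generates σ → LTL.Holds val σ φ) ∧ ∃ σ, R.Generates σ

/-- The elements of `Nᵢ`, in increasing order. -/
def nextList (R : Plan Q A) (i : Fin (R.n + 1)) : List (Fin (R.n + 1)) :=
  (List.finRange (R.n + 1)).filter (· ∈ R.next i)

end Plan

/-! ### Simplification of a plan -/

namespace Plan

variable {Q A : Type*}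

/-- All paths with `l` edges that start in plan state `i`. -/
def walks (R : Plan Q A) : ℕ → Fin (R.n + 1) → List (List (Fin (R.n + 1)))
  | 0, i => [[i]]
  | l + 1, i => (R.nextList i).flatMap fun j => (R.walks l j).map (i :: ·)

/-- A shortest path, with at least one edge, from `i` to `j`, or `[]` if there is none. -/
def shortestPath (R : Plan Q A) (i j : Fin (R.n + 1)) : List (Fin (R.n + 1)) :=
  ((List.range (R.n + 1)).findSome? fun l =>
    (R.walks (l + 1) i).find? fun s => s.getLast? = some j).getD []

/-- The reachable cycle `(prefix, suffix)`: for the first `i` such that there are a path from `i`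
to `i` and a path from the initial plan state to `i`, a shortest path of either kind. -/
def reachableCycle (R : Plan Q A) : List (Fin (R.n + 1)) × List (Fin (R.n + 1)) :=
  ((List.finRange (R.n + 1)).findSome? fun i =>
    if R.shortestPath i i ≠ [] ∧ R.shortestPath 0 i ≠ [] then
      some (R.shortestPath 0 i, R.shortestPath i i)
    else none).getD ([], [])

/-- The member that is kept of the group of all elements of `Nᵢ` with label `q`: one that follows
`i` in `prefix`, else one that follows `i` in `suffix`, else the first. -/
def kept [DecidableEq Q] (R : Plan Q A) (i : Fin (R.n + 1)) (q : Q) : Option (Fin (R.n + 1)) :=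
  let group := (R.nextList i).filter fun j => R.label j = q
  let c := R.reachableCycle
  (group.find? fun j => (i, j) ∈ c.1.zip c.1.tail) <|>
    (group.find? fun j => (i, j) ∈ c.2.zip c.2.tail) <|> group.head?

/-- The simplified plan: in each `Nᵢ`, one element of every group of equally labelled elements is
kept and the others are removed. -/
def simplify [DecidableEq Q] (R : Plan Q A) : Plan Q A where
  n := R.n
  label := R.label
  act := R.act
  next := fun i => (R.next i).filter fun j => R.kept i (R.label j) = some j

/-! ### The control strategy of a plan -/

/-- Follow the plan from plan state `c` along the given world states, if possible. -/
def follow [DecidableEq Q] (R : Plan Q A) : Fin (R.n + 1) → List Q → Option (Fin (R.n + 1))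
  | c, [] => some c
  | c, q :: s =>
    match (R.nextList c).find? fun j => R.label j = q with
    | some j => R.follow j s
    | none => none

/-- The control strategy produced from a plan: if the input starts with the initial world state
and the plan can be followed along it, the action of the plan state that is reached, and
otherwise the action of the initial plan state. -/
def strategy [DecidableEq Q] (R : Plan Q A) : Strategy Q A := fun s =>
  if s.1.head s.2 ≠ R.label 0 then R.act 0
  else
    match R.follow 0 s.1.tail with
    | some c => R.act c
    | none => R.act 0

end Plan

/-! ### The control strategy algorithm -/

/-- The transition function `succ_T` with the initial world state `q₀`: all actions have
duration `1`, and the successors of `q` under `a` are taken over all disturbance labels. -/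
def ATS.agent {Q A B O : Type*} [FinEnum Q] [FinEnum A] [FinEnum B] (T : ATS Q A B O)
    [∀ q a b q', Decidable (T.Trans q a b q')] (q₀ : Q) : ReactiveAgent Q A where
  init := q₀
  succ := fun q => (FinEnum.toList A).map fun a =>
    (a, 1, Finset.univ.filter fun q' => ∃ b, T.Trans q a b q')
  dur_pos := by
    intro q e he
    obtain ⟨a, -, rfl⟩ := List.mem_map.1 he
    exact one_pos

/-- A planning subroutine: from an agent, a formula and a valuation it returns a plan or fails. -/
abbrev Planner (Q A P : Type*) :=
  ReactiveAgent Q A → LTL P → (Q → Finset P) → Option (Plan Q A)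

/-- On the given input the planner is correct (a returned plan is a reactive plan of the agent
satisfying the formula) and complete (it returns a plan if there is such a reactive plan). -/
def Planner.Solves {Q A P : Type*} (K : Planner Q A P) (ag : ReactiveAgent Q A) (φ : LTL P)
    (val : Q → Finset P) : Prop :=
  (∀ R, K ag φ val = some R → R.IsPlanOf ag ∧ R.Satisfies val φ) ∧
  ((∃ R : Plan Q A, R.IsPlanOf ag ∧ R.Satisfies val φ) → ∃ R, K ag φ val = some R)

/-- The control strategy algorithm with planning subroutine `K`: for all `q₀ ∈ Q`, call `K` on
`(q₀, succ_T)`; as soon as it finds a plan, simplify it and return `q₀` and the strategy of the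
simplified plan. The answer "false" is `none`. -/
def controlStrategyAlgorithm {Q A B O P : Type*} [FinEnum Q] [FinEnum A] [FinEnum B]
    (K : Planner Q A P) (T : ATS Q A B O) [∀ q a b q', Decidable (T.Trans q a b q')]
    (φ : LTL P) (val : Q → Finset P) : Option (Q × Strategy Q A) :=
  (FinEnum.toList Q).findSome? fun q₀ =>
    (K (T.agent q₀) φ val).map fun R => (q₀, R.simplify.strategy)

/-! ### An effective planner: exhaustive search with model checking -/

namespace Plan

variable {Q A P : Type*}

instance decidableIsPlanOf [FinEnum Q] [FinEnum A] (R : Plan Q A) (ag : ReactiveAgent Q A) :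
    Decidable (R.IsPlanOf ag) := by
  unfold IsPlanOf ReactiveAgent.Step
  infer_instance

/-- A vertex of the tableau: a plan state and the set of the subformulae of `φ` that are guessed
to hold there. -/
abbrev Vertex (R : Plan Q A) (P : Type*) := Fin (R.n + 1) × Finset (LTL P)

section
variable [DecidableEq P]

/-- The guess respects the valuation and the Boolean connectives. -/
def localOK (R : Plan Q A) (val : Q → Finset P) (x : R.Vertex P) : LTL P → Bool
  | .atom p => decide (.atom p ∈ x.2 ↔ p ∈ val (R.label x.1))
  | .neg ψ => decide (.neg ψ ∈ x.2 ↔ ψ ∉ x.2)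
  | .conj ψ χ => decide (.conj ψ χ ∈ x.2 ↔ ψ ∈ x.2 ∧ χ ∈ x.2)
  | .untl _ _ => true

/-- The guesses at `x` and at its successor `y` respect the expansion law of "until". -/
def stepOK (x y : Finset (LTL P)) : LTL P → Bool
  | .untl ψ χ => decide (.untl ψ χ ∈ x ↔ χ ∈ x ∨ (ψ ∈ x ∧ .untl ψ χ ∈ y))
  | _ => true

/-- The guess at `y` does not leave the given formula as a pending "until". -/
def fulfils (y : Finset (LTL P)) : LTL P → Bool
  | .untl ψ χ => decide (.untl ψ χ ∉ y ∨ χ ∈ y)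
  | _ => true

/-- The vertices of the tableau of `φ` over the plan. -/
def vertices (R : Plan Q A) (val : Q → Finset P) (φ : LTL P) : Finset (R.Vertex P) :=
  (Finset.univ ×ˢ φ.subs.powerset).filter fun x => ∀ ψ ∈ φ.subs, R.localOK val x ψ

/-- The successors of a set of vertices in the tableau. -/
def post (R : Plan Q A) (val : Q → Finset P) (φ : LTL P) (X : Finset (R.Vertex P)) :
    Finset (R.Vertex P) :=
  (R.vertices val φ).filter fun y =>
    ∃ x ∈ X, y.1 ∈ R.next x.1 ∧ ∀ ψ ∈ φ.subs, stepOK x.2 y.2 ψ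

/-- The vertices reachable from `X` in any number of steps. -/
def reach (R : Plan Q A) (val : Q → Finset P) (φ : LTL P) (X : Finset (R.Vertex P)) :
    Finset (R.Vertex P) :=
  (fun Y => Y ∪ R.post val φ Y)^[(R.vertices val φ).card] X

/-- `y` is reachable from `x` in at least one step. -/
def reachPlus (R : Plan Q A) (val : Q → Finset P) (φ : LTL P) (x : R.Vertex P) :
    Finset (R.Vertex P) :=
  R.reach val φ (R.post val φ {x})

/-- `x` lies on a cycle on which every "until" is fulfilled. -/
def FairCycle (R : Plan Q A) (val : Q → Finset P) (φ : LTL P) (x : R.Vertex P) : Prop :=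
  x ∈ R.reachPlus val φ x ∧
  ∀ ψ ∈ φ.subs, ∃ y ∈ R.reachPlus val φ x, x ∈ R.reachPlus val φ y ∧ fulfils y.2 ψ

instance decidableFairCycle (R : Plan Q A) (val : Q → Finset P) (φ : LTL P) (x : R.Vertex P) :
    Decidable (R.FairCycle val φ x) := by
  unfold FairCycle
  infer_instance

/-- The guesses at the initial plan state from which a fair cycle is reachable: these are the sets
of subformulae of `φ` satisfied by the trajectories of the plan. -/
def fairGuesses (R : Plan Q A) (val : Q → Finset P) (φ : LTL P) : Finset (Finset (LTL P)) :=
  φ.subs.powerset.filter fun S =>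
    let x₀ : R.Vertex P := (0, S)
    x₀ ∈ R.vertices val φ ∧ ∃ x ∈ R.reach val φ {x₀}, R.FairCycle val φ x

/-- Model checking of a plan: some trajectory exists, and all trajectories satisfy `φ`. -/
def modelCheck (R : Plan Q A) (val : Q → Finset P) (φ : LTL P) : Bool :=
  decide ((R.fairGuesses val φ).Nonempty ∧ ∀ S ∈ R.fairGuesses val φ, φ ∈ S)

end

end Plan

/-- All plans with `n + 1` plan states. -/
def plansOfSize (Q A : Type*) [FinEnum Q] [FinEnum A] (n : ℕ) : List (Plan Q A) :=
  (FinEnum.toList (Fin (n + 1) → Q)).flatMap fun l =>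
    (FinEnum.toList (Fin (n + 1) → A)).flatMap fun a =>
      (FinEnum.toList (Fin (n + 1) → Finset (Fin (n + 1)))).map fun N => ⟨n, l, a, N⟩

/-- Exhaustive search, by increasing size, through the plans with at most `d` plan states; each
candidate is tested for being a reactive plan of the agent and model checked against `φ`. -/
def searchPlanner {Q A P : Type*} [FinEnum Q] [FinEnum A] [DecidableEq P] (d : ℕ) :
    Planner Q A P := fun ag φ val =>
  (List.range d).findSome? fun n =>
    (plansOfSize Q A n).find? fun R => decide (R.IsPlanOf ag) && R.modelCheck val φ

/-! ### Infinite paths in a relation -/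

section Paths

variable {α : Type*} {E : α → α → Prop}

/-- A path with at least one edge, as a function. -/
theorem exists_path_of_transGen {a b : α} (h : Relation.TransGen E a b) :
    ∃ (m : ℕ) (p : ℕ → α), p 0 = a ∧ p (m + 1) = b ∧ ∀ i ≤ m, E (p i) (p (i + 1)) := by
  induction h using Relation.TransGen.head_induction_on with
  | @single a h =>
    refine ⟨0, fun i => if i = 0 then a else b, by simp, by simp, fun i hi => ?_⟩
    obtain rfl : i = 0 := by omega
    simpa using h
  | @head a c h _ ih =>
    obtain ⟨m, p, h0, h1, h2⟩ := ih
    refine ⟨m + 1, fun i => Nat.casesOn i a p, rfl, h1, fun i hi => ?_⟩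
    cases i with
    | zero => simpa [h0] using h
    | succ i => exact h2 i (by omega)

/-- Successive milestones that are joined by paths all lie on one infinite path, which passes the
`k`-th milestone at time `k` or later. -/
theorem exists_path_through (z : ℕ → α) (hz : ∀ k, Relation.TransGen E (z k) (z (k + 1))) :
    ∃ ρ : ℕ → α, ρ 0 = z 0 ∧ (∀ t, E (ρ t) (ρ (t + 1))) ∧ ∀ k, ∃ t ≥ k, ρ t = z k := by
  choose m p h0 h1 h2 using fun k => exists_path_of_transGen (hz k)
  let step : ℕ × ℕ → ℕ × ℕ := fun s => if s.2 < m s.1 then (s.1, s.2 + 1) else (s.1 + 1, 0)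
  let s : ℕ → ℕ × ℕ := fun t => step^[t] (0, 0)
  have s_succ (t : ℕ) : s (t + 1) = step (s t) := Function.iterate_succ_apply' _ _ _
  have s_le (t : ℕ) : (s t).2 ≤ m (s t).1 := by
    induction t with
    | zero => exact Nat.zero_le _
    | succ t ih =>
      rw [s_succ]
      simp only [step]
      split_ifs with h
      · exact h
      · exact Nat.zero_le _
  have advance (k r : ℕ) : ∀ t i, s t = (k, i) → i + r = m k → s (t + r + 1) = (k + 1, 0) := by
    induction r with
    | zero =>
      intro t i ht hi
      rw [add_zero, s_succ, ht]
      simp [step, show ¬ i < m k by omega]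
    | succ r ih =>
      intro t i ht hi
      have := ih (t + 1) (i + 1) (by rw [s_succ, ht]; simp [step, show i < m k by omega])
        (by omega)
      rwa [show t + (r + 1) + 1 = t + 1 + r + 1 by omega]
  have visit (k : ℕ) : ∃ t ≥ k, s t = (k, 0) := by
    induction k with
    | zero => exact ⟨0, le_rfl, rfl⟩
    | succ k ih =>
      obtain ⟨t, htk, ht⟩ := ih
      exact ⟨t + m k + 1, by omega, advance k (m k) t 0 ht (by omega)⟩
  refine ⟨fun t => p (s t).1 (s t).2, h0 0, fun t => ?_, fun k => ?_⟩
  · have hE := h2 (s t).1 (s t).2 (s_le t)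
    simp only [s_succ, step]
    split_ifs with h
    · exact hE
    · have he : (s t).2 = m (s t).1 := le_antisymm (s_le t) (not_lt.1 h)
      rw [he, h1] at hE
      simpa [h0, he] using hE
  · obtain ⟨t, htk, ht⟩ := visit k
    exact ⟨t, htk, by simp [ht, h0]⟩

/-- If countably many goals can each be reached from `x` and left back to `x`, then some
infinite path that starts with a path to `x` satisfies each goal infinitely often. -/
theorem exists_path_infinitely_often {ι : Type*} [Countable ι] [Nonempty ι] {x₀ x : α}
    (F : ι → α → Prop) (h₀ : Relation.ReflTransGen E x₀ x)
    (h : ∀ i, ∃ y, Relation.TransGen E x y ∧ Relation.TransGen E y x ∧ F i y) :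
    ∃ ρ : ℕ → α, ρ 0 = x₀ ∧ (∀ t, E (ρ t) (ρ (t + 1))) ∧ ∀ i t, ∃ t' ≥ t, F i (ρ t') := by
  choose y hxy hyx hF using h
  obtain ⟨g, hg⟩ := exists_surjective_nat ι
  obtain ⟨ρ, hρ, hE, hz⟩ := exists_path_through (E := E)
    (fun k => Nat.casesOn k x₀ fun k => y (g k.unpair.1)) (by
      rintro (_ | k)
      · exact Relation.TransGen.trans_right h₀ (hxy _)
      · exact (hyx _).trans (hxy _))
  refine ⟨ρ, hρ, hE, fun i t => ?_⟩
  obtain ⟨n, rfl⟩ := hg i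
  obtain ⟨t', ht', h⟩ := hz (Nat.pair n t + 1)
  refine ⟨t', ?_, ?_⟩
  · have := Nat.right_le_pair n t
    omega
  · rw [h]
    simpa using hF (g n)

/-- The states of an infinite path are joined by paths. -/
theorem transGen_of_path {ρ : ℕ → α} (h : ∀ t, E (ρ t) (ρ (t + 1))) {s t : ℕ} (hst : s < t) :
    Relation.TransGen E (ρ s) (ρ t) := by
  induction t, hst using Nat.le_induction with
  | base => exact .single (h s)
  | succ t _ ih => exact ih.tail (h t)

end Paths

/-! ### Formulae -/

namespace LTL

variable {P : Type*}

theorem mem_subs_self [DecidableEq P] (φ : LTL P) : φ ∈ φ.subs := by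
  cases φ <;> simp [subs]

theorem subs_subset [DecidableEq P] {φ ψ : LTL P} (h : ψ ∈ φ.subs) : ψ.subs ⊆ φ.subs := by
  induction φ with
  | atom p =>
    simp only [subs, Finset.mem_singleton] at h
    rw [h]
  | neg φ ih =>
    rcases Finset.mem_insert.1 h with rfl | h
    · rfl
    · exact (ih h).trans (Finset.subset_insert _ _)
  | conj φ χ ih₁ ih₂ =>
    rcases Finset.mem_insert.1 h with rfl | h
    · rfl
    · rcases Finset.mem_union.1 h with h | h
      · exact (ih₁ h).trans (Finset.subset_union_left.trans (Finset.subset_insert _ _))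
      · exact (ih₂ h).trans (Finset.subset_union_right.trans (Finset.subset_insert _ _))
  | untl φ χ ih₁ ih₂ =>
    rcases Finset.mem_insert.1 h with rfl | h
    · rfl
    · rcases Finset.mem_union.1 h with h | h
      · exact (ih₁ h).trans (Finset.subset_union_left.trans (Finset.subset_insert _ _))
      · exact (ih₂ h).trans (Finset.subset_union_right.trans (Finset.subset_insert _ _))

theorem mem_subs_of_neg [DecidableEq P] {φ ψ : LTL P} (h : ψ.neg ∈ φ.subs) : ψ ∈ φ.subs :=
  subs_subset h (by simp [subs, mem_subs_self])

theorem mem_subs_of_conj [DecidableEq P] {φ ψ χ : LTL P} (h : ψ.conj χ ∈ φ.subs) :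
    ψ ∈ φ.subs ∧ χ ∈ φ.subs :=
  ⟨subs_subset h (by simp [subs, mem_subs_self]), subs_subset h (by simp [subs, mem_subs_self])⟩

theorem mem_subs_of_untl [DecidableEq P] {φ ψ χ : LTL P} (h : ψ.untl χ ∈ φ.subs) :
    ψ ∈ φ.subs ∧ χ ∈ φ.subs :=
  ⟨subs_subset h (by simp [subs, mem_subs_self]), subs_subset h (by simp [subs, mem_subs_self])⟩

/-- The expansion law of "until". -/
theorem satAt_untl_iff (w : ℕ → Finset P) (φ ψ : LTL P) (i : ℕ) :
    SatAt w (untl φ ψ) i ↔ SatAt w ψ i ∨ SatAt w φ i ∧ SatAt w (untl φ ψ) (i + 1) := by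
  constructor
  · rintro ⟨j, hij, hj, h⟩
    rcases hij.eq_or_lt with rfl | hlt
    · exact .inl hj
    · exact .inr ⟨h i le_rfl hlt, j, hlt, hj, fun k hk => h k (by omega)⟩
  · rintro (h | ⟨h, j, hij, hj, hk⟩)
    · exact ⟨i, le_rfl, h, fun k _ _ => by omega⟩
    · refine ⟨j, by omega, hj, fun k hik hkj => ?_⟩
      rcases hik.eq_or_lt with rfl | hlt
      · exact h
      · exact hk k hlt hkj

open Classical in
/-- The subformulae of `φ` that hold at position `t`. -/
noncomputable def trueSubs [DecidableEq P] (w : ℕ → Finset P) (φ : LTL P) (t : ℕ) : Finset (LTL P) :=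
  φ.subs.filter fun ψ => SatAt w ψ t

theorem mem_trueSubs [DecidableEq P] {w : ℕ → Finset P} {φ ψ : LTL P} {t : ℕ} :
    ψ ∈ trueSubs w φ t ↔ ψ ∈ φ.subs ∧ SatAt w ψ t := by
  simp [trueSubs]

end LTL

/-! ### Correctness of the model checker -/

namespace Plan

variable {Q A P : Type*}

section
variable [DecidableEq P] (R : Plan Q A) (val : Q → Finset P) (φ : LTL P)

/-- The edges of the tableau. -/
def Edge (x y : R.Vertex P) : Prop :=
  y ∈ R.vertices val φ ∧ y.1 ∈ R.next x.1 ∧ ∀ ψ ∈ φ.subs, stepOK x.2 y.2 ψ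

variable {R val φ}

theorem mem_post {X : Finset (R.Vertex P)} {y : R.Vertex P} :
    y ∈ R.post val φ X ↔ ∃ x ∈ X, R.Edge val φ x y := by
  simp only [post, Finset.mem_filter, Edge]
  constructor
  · rintro ⟨hy, x, hx, h⟩
    exact ⟨x, hx, hy, h⟩
  · rintro ⟨x, hx, hy, h⟩
    exact ⟨hy, x, hx, h⟩

theorem post_reach_subset (X : Finset (R.Vertex P)) :
    R.post val φ (R.reach val φ X) ⊆ R.reach val φ X := by
  have hV (Y : Finset (R.Vertex P)) : R.post val φ Y ⊆ R.vertices val φ := Finset.filter_subset _ _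
  have key (k : ℕ) :
      R.post val φ ((fun Y => Y ∪ R.post val φ Y)^[k] X) ⊆
          (fun Y => Y ∪ R.post val φ Y)^[k] X ∨
        k ≤ (((fun Y => Y ∪ R.post val φ Y)^[k] X) ∩ R.vertices val φ).card := by
    induction k with
    | zero => exact .inr (Nat.zero_le _)
    | succ k ih =>
      simp only [Function.iterate_succ_apply']
      generalize (fun Y => Y ∪ R.post val φ Y)^[k] X = Y at ih
      by_cases hY : R.post val φ Y ⊆ Y
      · left
        rw [Finset.union_eq_left.2 hY]
        exact hY
      · right
        have hk := ih.resolve_left hY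
        obtain ⟨y, hy, hyY⟩ := Finset.not_subset.1 hY
        refine Nat.succ_le_of_lt (hk.trans_lt (Finset.card_lt_card ?_))
        refine Finset.ssubset_iff_subset_ne.2
          ⟨Finset.inter_subset_inter_right Finset.subset_union_left, fun h => hyY ?_⟩
        have : y ∈ (Y ∪ R.post val φ Y) ∩ R.vertices val φ :=
          Finset.mem_inter.2 ⟨Finset.mem_union_right _ hy, hV _ hy⟩
        rw [← h] at this
        exact (Finset.mem_inter.1 this).1
  rcases key (R.vertices val φ).card with h | h
  · exact h
  · have := Finset.eq_of_subset_of_card_le Finset.inter_subset_right h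
    exact (hV _).trans (Finset.inter_eq_right.1 this)

theorem mem_reach {X : Finset (R.Vertex P)} {y : R.Vertex P} :
    y ∈ R.reach val φ X ↔ ∃ x ∈ X, Relation.ReflTransGen (R.Edge val φ) x y := by
  constructor
  · have key (k : ℕ) : ∀ y ∈ (fun Y => Y ∪ R.post val φ Y)^[k] X,
        ∃ x ∈ X, Relation.ReflTransGen (R.Edge val φ) x y := by
      induction k with
      | zero => exact fun y hy => ⟨y, hy, .refl⟩
      | succ k ih =>
        intro y hy
        rw [Function.iterate_succ_apply'] at hy
        rcases Finset.mem_union.1 hy with hy | hy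
        · exact ih y hy
        · obtain ⟨z, hz, hzy⟩ := mem_post.1 hy
          obtain ⟨x, hx, hxz⟩ := ih z hz
          exact ⟨x, hx, hxz.tail hzy⟩
    exact key _ y
  · rintro ⟨x, hx, h⟩
    induction h with
    | refl =>
      have key (k : ℕ) : x ∈ (fun Y => Y ∪ R.post val φ Y)^[k] X := by
        induction k with
        | zero => exact hx
        | succ k ih =>
          rw [Function.iterate_succ_apply']
          exact Finset.mem_union_left _ ih
      exact key _
    | tail _ h ih => exact post_reach_subset X (mem_post.2 ⟨_, ih, h⟩)

theorem mem_reachPlus {x y : R.Vertex P} :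
    y ∈ R.reachPlus val φ x ↔ Relation.TransGen (R.Edge val φ) x y := by
  simp only [reachPlus, mem_reach, mem_post, Finset.mem_singleton, exists_eq_left]
  exact Relation.TransGen.head'_iff.symm

theorem mem_vertices {x : R.Vertex P} :
    x ∈ R.vertices val φ ↔ x.2 ⊆ φ.subs ∧ ∀ ψ ∈ φ.subs, R.localOK val x ψ := by
  simp [vertices]

/-- Along a path of the tableau that fulfils every "until" infinitely often, the guesses are
right. -/
theorem mem_guess_iff_satAt {r : ℕ → R.Vertex P} (hV : ∀ t, r t ∈ R.vertices val φ)
    (hE : ∀ t, R.Edge val φ (r t) (r (t + 1)))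
    (hF : ∀ ψ ∈ φ.subs, ∀ t, ∃ t' ≥ t, fulfils (r t').2 ψ) {ψ : LTL P} (hψ : ψ ∈ φ.subs) (t : ℕ) :
    ψ ∈ (r t).2 ↔ LTL.SatAt (fun i => val (R.label (r i).1)) ψ t := by
  have hloc := fun t => (mem_vertices.1 (hV t)).2
  induction ψ generalizing t with
  | atom p => simpa [localOK, LTL.SatAt] using hloc t _ hψ
  | neg ψ ih =>
    have := hloc t _ hψ
    simp only [localOK, decide_eq_true_eq] at this
    exact this.trans (not_congr (ih (LTL.mem_subs_of_neg hψ) t))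
  | conj ψ χ ih₁ ih₂ =>
    have := hloc t _ hψ
    simp only [localOK, decide_eq_true_eq] at this
    exact this.trans (and_congr (ih₁ (LTL.mem_subs_of_conj hψ).1 t)
      (ih₂ (LTL.mem_subs_of_conj hψ).2 t))
  | untl ψ χ ih₁ ih₂ =>
    have hstep (t : ℕ) : ψ.untl χ ∈ (r t).2 ↔
        χ ∈ (r t).2 ∨ ψ ∈ (r t).2 ∧ ψ.untl χ ∈ (r (t + 1)).2 := by
      exact of_decide_eq_true ((hE t).2.2 _ hψ)
    simp only [ih₁ (LTL.mem_subs_of_untl hψ).1, ih₂ (LTL.mem_subs_of_untl hψ).2] at hstep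
    constructor
    · intro h
      obtain ⟨t', htt', ht'⟩ := hF _ hψ t
      obtain ⟨d, rfl⟩ := Nat.exists_eq_add_of_le htt'
      simp only [fulfils, decide_eq_true_eq, ih₂ (LTL.mem_subs_of_untl hψ).2] at ht'
      clear htt'
      induction d generalizing t with
      | zero => exact (LTL.satAt_untl_iff ..).2 (.inl (ht'.resolve_left (not_not.2 h)))
      | succ d ih =>
        refine (LTL.satAt_untl_iff ..).2 (((hstep t).1 h).imp_right fun h => ⟨h.1, ?_⟩)
        refine ih (t + 1) h.2 ?_
        rwa [show t + 1 + d = t + (d + 1) by omega]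
    · rintro ⟨j, htj, hj, h⟩
      obtain ⟨d, rfl⟩ := Nat.exists_eq_add_of_le htj
      clear htj
      induction d generalizing t with
      | zero => exact (hstep t).2 (.inl hj)
      | succ d ih =>
        refine (hstep t).2 (.inr ⟨h t le_rfl (by omega), ih (t + 1) ?_ fun k h₁ h₂ => ?_⟩)
        · rwa [show t + 1 + d = t + (d + 1) by omega]
        · exact h k (by omega) (by omega)

/-- The fair guesses are the sets of subformulae satisfied by the trajectories of the plan. -/
theorem mem_fairGuesses {S : Finset (LTL P)} :
    S ∈ R.fairGuesses val φ ↔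
      ∃ σ, R.Generates σ ∧ S = LTL.trueSubs (fun i => val (σ i)) φ 0 := by
  rw [fairGuesses, Finset.mem_filter]
  simp only [Finset.mem_powerset, mem_reach, Finset.mem_singleton, exists_eq_left, FairCycle, mem_reachPlus]
  constructor
  · rintro ⟨hS, hv, x, hx, -, hfair⟩
    have : Nonempty φ.subs := ⟨⟨φ, φ.mem_subs_self⟩⟩
    obtain ⟨r, hr, hE, hF⟩ := exists_path_infinitely_often
      (fun (ψ : φ.subs) (y : R.Vertex P) => fulfils y.2 ψ = true) hx fun ψ => hfair ψ ψ.2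
    have hV (t : ℕ) : r t ∈ R.vertices val φ := by
      cases t with
      | zero => rwa [hr]
      | succ t => exact (hE t).1
    refine ⟨fun t => R.label (r t).1,
      ⟨fun t => (r t).1, by simp [hr], fun t => ⟨(hE t).2.1, rfl⟩⟩, ?_⟩
    ext ψ
    rw [LTL.mem_trueSubs]
    by_cases hψ : ψ ∈ φ.subs
    · have := mem_guess_iff_satAt hV hE (fun ψ hψ => hF ⟨ψ, hψ⟩) hψ 0
      rw [hr] at this
      simpa [hψ] using this
    · exact iff_of_false (fun h => hψ (hS h)) fun h => hψ h.1
  · rintro ⟨σ, ⟨ρ, hρ₀, hρ⟩, rfl⟩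
    set w : ℕ → Finset P := fun i => val (σ i) with hw
    let r : ℕ → R.Vertex P := fun t => (ρ t, LTL.trueSubs w φ t)
    have hV (t : ℕ) : r t ∈ R.vertices val φ := by
      refine mem_vertices.2 ⟨fun ψ h => (LTL.mem_trueSubs.1 h).1, fun ψ hψ => ?_⟩
      cases ψ with
      | atom p => simp [localOK, r, LTL.mem_trueSubs, hψ, LTL.SatAt, hw, (hρ t).2]
      | neg ψ => simp [localOK, r, LTL.mem_trueSubs, hψ, LTL.SatAt, LTL.mem_subs_of_neg hψ]
      | conj ψ χ => simp [localOK, r, LTL.mem_trueSubs, hψ, LTL.SatAt, LTL.mem_subs_of_conj hψ]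
      | untl ψ χ => rfl
    have hE (t : ℕ) : R.Edge val φ (r t) (r (t + 1)) := by
      refine ⟨hV _, (hρ t).1, fun ψ hψ => ?_⟩
      cases ψ with
      | untl ψ χ =>
        simp only [stepOK, r, LTL.mem_trueSubs, hψ, LTL.mem_subs_of_untl hψ, true_and,
          decide_eq_true_eq]
        exact LTL.satAt_untl_iff ..
      | _ => rfl
    have hF (ψ : LTL P) (hψ : ψ ∈ φ.subs) (t : ℕ) : ∃ t' ≥ t, fulfils (r t').2 ψ := by
      cases ψ with
      | untl ψ χ =>
        by_cases h : LTL.SatAt w (ψ.untl χ) t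
        · obtain ⟨j, htj, hj, -⟩ := h
          exact ⟨j, htj, by simp [fulfils, r, LTL.mem_trueSubs, LTL.mem_subs_of_untl hψ, hj]⟩
        · exact ⟨t, le_rfl, by simp [fulfils, r, LTL.mem_trueSubs, h]⟩
      | _ => exact ⟨t, le_rfl, rfl⟩
    obtain ⟨x, hx⟩ : ∃ x, ∃ᶠ t in Filter.atTop, r t = x := by
      obtain ⟨⟨x, hxV⟩, hx⟩ := Finite.exists_infinite_fiber
        (fun t => (⟨r t, hV t⟩ : R.vertices val φ))
      refine ⟨x, Nat.frequently_atTop_iff_infinite.2 ?_⟩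
      convert Set.infinite_coe_iff.1 hx using 1
      ext t
      simp
    rw [Filter.frequently_atTop] at hx
    have hr0 : r 0 = ((0, LTL.trueSubs w φ 0) : R.Vertex P) := by simp [r, hρ₀]
    rw [← hr0]
    obtain ⟨s, -, rfl⟩ := hx 0
    obtain ⟨s', hs', hss'⟩ := hx (s + 1)
    refine ⟨(mem_vertices.1 (hV 0)).1, hV 0, r s, ?_, ?_, fun ψ hψ => ?_⟩
    · rcases s.eq_zero_or_pos with rfl | hs
      · exact .refl
      · exact (transGen_of_path hE hs).to_reflTransGen
    · have := transGen_of_path hE hs'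
      rwa [hss'] at this
    · obtain ⟨t, hst, ht⟩ := hF ψ hψ (s + 1)
      obtain ⟨u, hu, hus⟩ := hx (t + 1)
      refine ⟨r t, transGen_of_path hE hst, ?_, ht⟩
      rw [← hus]
      exact transGen_of_path hE hu

theorem modelCheck_iff_satisfies : R.modelCheck val φ = true ↔ R.Satisfies val φ := by
  have hφ (σ : ℕ → Q) : φ ∈ LTL.trueSubs (fun i => val (σ i)) φ 0 ↔ LTL.Holds val σ φ := by
    simp [LTL.mem_trueSubs, LTL.mem_subs_self, LTL.Holds]
  rw [modelCheck, decide_eq_true_iff]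
  simp only [Finset.Nonempty, mem_fairGuesses, Satisfies]
  constructor
  · rintro ⟨⟨S, σ, hσ, -⟩, h⟩
    exact ⟨fun σ hσ => (hφ σ).1 (h _ ⟨σ, hσ, rfl⟩), σ, hσ⟩
  · rintro ⟨h, σ, hσ⟩
    refine ⟨⟨_, σ, hσ, rfl⟩, ?_⟩
    rintro S ⟨σ, hσ, rfl⟩
    exact (hφ σ).2 (h σ hσ)

end

/-! ### The strategy of a simplified plan -/

theorem mem_nextList {R : Plan Q A} {i j : Fin (R.n + 1)} : j ∈ R.nextList i ↔ j ∈ R.next i := by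
  simp [nextList]

theorem seqPrefix_tail_succ (σ : ℕ → Q) (t : ℕ) :
    (seqPrefix σ (t + 1)).1.tail = (seqPrefix σ t).1.tail ++ [σ (t + 1)] := by
  simp only [seqPrefix]
  rw [List.range_succ, List.map_append, List.tail_append_of_ne_nil (by simp)]
  rfl

theorem head_seqPrefix (σ : ℕ → Q) (t : ℕ) : (seqPrefix σ t).1.head (seqPrefix σ t).2 = σ 0 := by
  simp [seqPrefix, List.range_succ_eq_map]

section
variable [DecidableEq Q]

/-- Simplification keeps a member of every group. -/
theorem exists_mem_simplify_next {R : Plan Q A} {i j : Fin (R.n + 1)} (hj : j ∈ R.next i) :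
    ∃ j' ∈ R.simplify.next i, R.label j' = R.label j := by
  obtain ⟨j', hj', hmem⟩ : ∃ j', R.kept i (R.label j) = some j' ∧
      j' ∈ (R.nextList i).filter fun k => R.label k = R.label j := by
    have hne : j ∈ (R.nextList i).filter fun k => R.label k = R.label j := by
      simp [mem_nextList, hj]
    simp only [kept]
    generalize (R.nextList i).filter (fun k => R.label k = R.label j) = g at hne ⊢
    cases h₁ : g.find? fun k => (i, k) ∈ R.reachableCycle.1.zip R.reachableCycle.1.tail with
    | some k => exact ⟨k, rfl, List.mem_of_find?_eq_some h₁⟩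
    | none =>
      cases h₂ : g.find? fun k => (i, k) ∈ R.reachableCycle.2.zip R.reachableCycle.2.tail with
      | some k => exact ⟨k, rfl, List.mem_of_find?_eq_some h₂⟩
      | none =>
        cases g with
        | nil => simp at hne
        | cons k g => exact ⟨k, rfl, by simp⟩
  obtain ⟨h₁, h₂⟩ : j' ∈ R.next i ∧ R.label j' = R.label j := by
    simpa [mem_nextList] using hmem
  refine ⟨j', ?_, h₂⟩
  change j' ∈ (R.next i).filter fun k => R.kept i (R.label k) = some k
  rw [Finset.mem_filter, h₂]
  exact ⟨h₁, hj'⟩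

theorem Generates.of_simplify {R : Plan Q A} {σ : ℕ → Q} (h : R.simplify.Generates σ) :
    R.Generates σ := by
  obtain ⟨ρ, h0, h⟩ := h
  exact ⟨ρ, h0, fun t => ⟨Finset.filter_subset _ _ (h t).1, (h t).2⟩⟩

theorem follow_append (R : Plan Q A) (c : Fin (R.n + 1)) (s s' : List Q) :
    R.follow c (s ++ s') = (R.follow c s).bind fun d => R.follow d s' := by
  induction s generalizing c with
  | nil => rfl
  | cons q s ih =>
    simp only [List.cons_append, follow]
    split
    · exact ih _
    · rfl

theorem follow_singleton_of_exists {R : Plan Q A} {c j : Fin (R.n + 1)} (hj : j ∈ R.next c) :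
    ∃ j' ∈ R.next c, R.label j' = R.label j ∧ R.follow c [R.label j] = some j' := by
  cases h : (R.nextList c).find? fun k => R.label k = R.label j with
  | none =>
    have := List.find?_eq_none.1 h j (mem_nextList.2 hj)
    simp at this
  | some k =>
    refine ⟨k, mem_nextList.1 (List.mem_of_find?_eq_some h), by simpa using List.find?_some h, ?_⟩
    simp [follow, h]

/-- If every disturbance allowed by the prescribed actions is answered by the plan, the sequences
that are consistent with the strategy of the plan are generated by the plan. -/
theorem generates_of_strategy {R : Plan Q A} {σ : ℕ → Q} {Step : Q → A → Q → Prop}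
    (hR : ∀ i q', Step (R.label i) (R.act i) q' → ∃ j ∈ R.next i, R.label j = q')
    (h0 : σ 0 = R.label 0) (hσ : ∀ t, Step (σ t) (R.strategy (seqPrefix σ t)) (σ (t + 1))) :
    R.Generates σ := by
  have hstrat {t : ℕ} {c : Fin (R.n + 1)} (h : R.follow 0 (seqPrefix σ t).1.tail = some c) :
      R.strategy (seqPrefix σ t) = R.act c := by
    simp [strategy, head_seqPrefix, h0, h]
  have hnext {t : ℕ} {c : Fin (R.n + 1)} (h : R.follow 0 (seqPrefix σ t).1.tail = some c)
      (hc : R.label c = σ t) : ∃ j ∈ R.next c, R.label j = σ (t + 1) ∧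
        R.follow 0 (seqPrefix σ (t + 1)).1.tail = some j := by
    have := hσ t
    rw [hstrat h, ← hc] at this
    obtain ⟨j, hj, hjl⟩ := hR c _ this
    obtain ⟨j', hj', hl, hf⟩ := follow_singleton_of_exists hj
    refine ⟨j', hj', hl.trans hjl, ?_⟩
    rw [seqPrefix_tail_succ, follow_append, h, ← hjl]
    exact hf
  have hall (t : ℕ) : ∃ c, R.follow 0 (seqPrefix σ t).1.tail = some c ∧ R.label c = σ t := by
    induction t with
    | zero => exact ⟨0, rfl, h0.symm⟩
    | succ t ih =>
      obtain ⟨c, hc, hl⟩ := ih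
      obtain ⟨j, -, hjl, hj⟩ := hnext hc hl
      exact ⟨j, hj, hjl⟩
  choose ρ hf hl using hall
  refine ⟨ρ, ?_, fun t => ⟨?_, hl t⟩⟩
  · exact (Option.some.inj (hf 0)).symm
  · obtain ⟨j, hj, -, hjf⟩ := hnext (hf t) (hl t)
    rw [hf (t + 1)] at hjf
    rwa [Option.some.inj hjf]

end

end Plan

/-! ### The control strategy algorithm -/

section Algorithm

variable {Q A B O P : Type*} [FinEnum Q] [FinEnum A]

theorem mem_plansOfSize (R : Plan Q A) : R ∈ plansOfSize Q A R.n := by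
  simp only [plansOfSize, List.mem_flatMap, List.mem_map]
  exact ⟨R.label, FinEnum.mem_toList _, R.act, FinEnum.mem_toList _, R.next,
    FinEnum.mem_toList _, rfl⟩

theorem searchPlanner_sound [DecidableEq P] {d : ℕ} {ag : ReactiveAgent Q A} {φ : LTL P}
    {val : Q → Finset P} {R : Plan Q A} (h : searchPlanner d ag φ val = some R) :
    R.IsPlanOf ag ∧ R.Satisfies val φ := by
  obtain ⟨n, -, hn⟩ := List.exists_of_findSome?_eq_some h
  have := List.find?_some hn
  rwa [Bool.and_eq_true, decide_eq_true_eq, Plan.modelCheck_iff_satisfies] at this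

theorem searchPlanner_complete [DecidableEq P] {d : ℕ} {ag : ReactiveAgent Q A} {φ : LTL P}
    {val : Q → Finset P} {R : Plan Q A} (hR : R.IsPlanOf ag) (hφ : R.Satisfies val φ)
    (hd : R.n < d) : ∃ R', searchPlanner d ag φ val = some R' := by
  rw [← Option.isSome_iff_exists, searchPlanner, List.findSome?_isSome_iff]
  refine ⟨R.n, List.mem_range.2 hd, List.find?_isSome.2 ⟨R, mem_plansOfSize R, ?_⟩⟩
  rw [Bool.and_eq_true, decide_eq_true_eq, Plan.modelCheck_iff_satisfies]
  exact ⟨hR, hφ⟩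

variable [FinEnum B] (T : ATS Q A B O) [∀ q a b q', Decidable (T.Trans q a b q')]

theorem ATS.agent_step {q₀ q q' : Q} {a : A} :
    (T.agent q₀).Step q a q' ↔ ∃ b, T.Trans q a b q' := by
  simp [ReactiveAgent.Step, ATS.agent]

theorem searchPlanner_solves [DecidableEq P] (φ : LTL P) (val : Q → Finset P) :
    ∃ d₀ : ℕ, ∀ d ≥ d₀, ∀ q₀ : Q,
      (searchPlanner d : Planner Q A P).Solves (T.agent q₀) φ val := by
  have (q₀ : Q) : ∃ m : ℕ, (∃ R : Plan Q A, R.IsPlanOf (T.agent q₀) ∧ R.Satisfies val φ) →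
      ∃ R : Plan Q A, R.IsPlanOf (T.agent q₀) ∧ R.Satisfies val φ ∧ R.n < m := by
    by_cases h : ∃ R : Plan Q A, R.IsPlanOf (T.agent q₀) ∧ R.Satisfies val φ
    · obtain ⟨R, h₁, h₂⟩ := h
      exact ⟨R.n + 1, fun _ => ⟨R, h₁, h₂, Nat.lt_succ_self _⟩⟩
    · exact ⟨0, fun h' => absurd h' h⟩
  choose m hm using this
  refine ⟨Finset.univ.sup m, fun d hd q₀ => ⟨fun R => searchPlanner_sound, fun h => ?_⟩⟩
  obtain ⟨R, h₁, h₂, h₃⟩ := hm q₀ h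
  exact searchPlanner_complete h₁ h₂
    (h₃.trans_le ((Finset.le_sup (Finset.mem_univ q₀)).trans hd))

/-- The outcomes of the strategy of a simplified plan are generated by the plan. -/
theorem Plan.generates_of_mem_out {q₀ : Q} {R : Plan Q A} (hR : R.IsPlanOf (T.agent q₀))
    {σ : ℕ → Q} (hσ : σ ∈ T.Out q₀ R.simplify.strategy) : R.Generates σ := by
  refine Plan.Generates.of_simplify (Plan.generates_of_strategy
    (Step := (T.agent q₀).Step) (fun i q' h => ?_) (hσ.1.trans hR.1.symm)
    fun t => (T.agent_step).2 (hσ.2 t))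
  obtain ⟨j, hj, rfl⟩ := hR.2.2.1 i q' h
  exact Plan.exists_mem_simplify_next hj

theorem controlStrategyAlgorithm_sound {K : Planner Q A P} {φ : LTL P} {val : Q → Finset P}
    (hK : ∀ q₀ R, K (T.agent q₀) φ val = some R →
      R.IsPlanOf (T.agent q₀) ∧ R.Satisfies val φ)
    {q : Q} {f : Strategy Q A} (h : controlStrategyAlgorithm K T φ val = some (q, f)) :
    ∀ σ ∈ T.Out q f, LTL.Holds val σ φ := by
  obtain ⟨q₀, -, hq⟩ := List.exists_of_findSome?_eq_some h
  obtain ⟨R, hR, he⟩ := Option.map_eq_some_iff.1 hq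
  cases he
  obtain ⟨h₁, h₂⟩ := hK _ R hR
  exact fun σ hσ => h₂.1 σ (Plan.generates_of_mem_out T h₁ hσ)

theorem controlStrategyAlgorithm_complete {K : Planner Q A P} {φ : LTL P} {val : Q → Finset P}
    {q₀ : Q} {R : Plan Q A} (h : K (T.agent q₀) φ val = some R) :
    ∃ q f, controlStrategyAlgorithm K T φ val = some (q, f) := by
  have : (controlStrategyAlgorithm K T φ val).isSome := by
    rw [controlStrategyAlgorithm, List.findSome?_isSome_iff]
    exact ⟨q₀, FinEnum.mem_toList _, by simp [h]⟩
  obtain ⟨⟨q, f⟩, h⟩ := Option.isSome_iff_exists.1 this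
  exact ⟨q, f, h⟩

end Algorithm

theorem mainTheorem4 {Q A B O P : Type*} [FinEnum Q] [FinEnum A] [FinEnum B] [FinEnum P]
    (T : ATS Q A B O) [∀ q a b q', Decidable (T.Trans q a b q')] (hT : T.NonBlocking)
    (φ : LTL P) (val : Q → Finset P)
    (hplan : ∃ (q₀ : Q) (R : Plan Q A), R.IsPlanOf (T.agent q₀) ∧ R.Satisfies val φ) :
    -- with any planner that is correct and complete on the agents of `T`, the algorithm succeeds
    (∀ K : Planner Q A P, (∀ q₀ : Q, K.Solves (T.agent q₀) φ val) →
      ∃ (q : Q) (f : Strategy Q A), controlStrategyAlgorithm K T φ val = some (q, f) ∧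
        ∀ σ ∈ T.Out q f, LTL.Holds val σ φ) ∧
    -- exhaustive search is such a planner once its search bound is large enough
    (∃ d₀ : ℕ, ∀ d ≥ d₀, ∀ q₀ : Q,
      (searchPlanner d : Planner Q A P).Solves (T.agent q₀) φ val) ∧
    -- running the algorithm with search bounds `0, 1, 2, …` terminates and succeeds
    (∃ (q : Q) (f : Strategy Q A),
      (q, f) ∈ Nat.rfindOpt (fun d => controlStrategyAlgorithm (searchPlanner d) T φ val) ∧
        ∀ σ ∈ T.Out q f, LTL.Holds val σ φ) := by
  obtain ⟨q₀, R₀, hR₀, hφ₀⟩ := hplan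
  obtain ⟨d₀, hd₀⟩ := searchPlanner_solves T φ val
  have succeeds (K : Planner Q A P) (hK : ∀ q₀ : Q, K.Solves (T.agent q₀) φ val) :
      ∃ q f, controlStrategyAlgorithm K T φ val = some (q, f) := by
    obtain ⟨R, hR⟩ := (hK q₀).2 ⟨R₀, hR₀, hφ₀⟩
    exact controlStrategyAlgorithm_complete T hR
  refine ⟨fun K hK => ?_, ⟨d₀, hd₀⟩, ?_⟩
  · obtain ⟨q, f, h⟩ := succeeds K hK
    exact ⟨q, f, h, controlStrategyAlgorithm_sound T (fun q₀ => (hK q₀).1) h⟩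
  · obtain ⟨q, f, h⟩ := succeeds (searchPlanner d₀) (hd₀ d₀ le_rfl)
    obtain ⟨⟨q', f'⟩, hr⟩ := Part.dom_iff_mem.1 (Nat.rfindOpt_dom
      (f := fun d => controlStrategyAlgorithm (searchPlanner d) T φ val).2 ⟨d₀, (q, f), h⟩)
    obtain ⟨d, hd⟩ := Nat.rfindOpt_spec hr
    exact ⟨q', f', hr, controlStrategyAlgorithm_sound T (fun q₀ R => searchPlanner_sound) hd⟩
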